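/- There is an absolute constant $c_1>0$ such that for every $\beta\in(0,1)$ there is a constant $\alpha=\alpha(\beta)>1$, depending only on $\beta$, with the following property. Let $n\geq 1$ be an integer, let $K\subset\mathbb{R}^n$ be a centered convex body, i.e. a compact convex set with non-empty interior whose center of mass $\frac{1}{|K|}\int_K x\,dx$ is the origin, let $N$ be an integer with $\alpha n\leq N\leq e^n$, and let $x_1,\ldots,x_N$ be independent random points uniformly distributed in $K$. Then, with probability greater than $1-e^{-N^{1-\beta}n^{\beta}}$, $$\operatorname{conv}(\{x_1,\ldots,x_N\})\supseteq \frac{c_1\beta\log(N/n)}{n}\,K .$$ -/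

import Mathlib

open MeasureTheory ProbabilityTheory
open scoped Pointwise

/-- A convex body in `ℝⁿ`: a compact convex set with non-empty interior. -/
structure IsConvexBody {n : ℕ} (K : Set (EuclideanSpace ℝ (Fin n))) : Prop where
  convex : Convex ℝ K
  isCompact : IsCompact K
  interior_nonempty : (interior K).Nonempty

/-- The center of mass `bar(K) = |K|⁻¹ ∫_K x dx`. -/
noncomputable def barycenter {n : ℕ} (K : Set (EuclideanSpace ℝ (Fin n))) :
    EuclideanSpace ℝ (Fin n) :=
  (volume.real K)⁻¹ • ∫ x in K, x

/-- A set is centered if its center of mass is the origin. -/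
def IsCentered {n : ℕ} (K : Set (EuclideanSpace ℝ (Fin n))) : Prop :=
  barycenter K = 0

/-!
Write `u = N / n` and `r = β log u / (4 n)`, so `c₁ = 1 / 4`; the assumption `N ≤ eⁿ` gives
`r ≤ 1 / 4`.

*Caps are heavy.* By Grünbaum's inequality (`exp_neg_one_mul_volume_le`) every halfspace with the
origin on its boundary contains at least the fraction `1 / e` of the centered body `K`. If a
halfspace meets `r K` in `r y`, with `y ∈ K`, then the homothety `x ↦ (1 - r) x + r y` maps such a
half of `K` into the cap cut off by it, so the cap has relative volume at least
`(1 - r)ⁿ / e ≥ p := u ^ (-β / 2) / e` (`one_sub_pow_mul_exp_neg_one_le`). Grünbaum's inequality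
is Jensen's inequality for `log F`, where `F t` is the relative volume of `{x ∈ K | t ≤ ⟪θ, x⟫}`:
the function `F` is log-concave by the multiplicative Brunn–Minkowski inequality, which follows
from the Prékopa–Leindler inequality (`prekopa_leindler`), and `E log F(⟪θ, X⟫) ≥ -1`.

*Few caps matter.* If the convex hull of the sample misses a point of `r K`, then some facet
hyperplane, spanned by `n` of the points, separates them, and the cap beyond it contains no sample
point. For a fixed choice of `n` points this has probability at most `(1 - p) ^ (N - n)`, by
independence (`measure_forall_notMem_le`), and a union bound over the choices finishes the proof:
the exponent `p (N - n)`, of order `n u ^ (1 - β / 2)`, beats both the entropy of order `n log u`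
and the required `n u ^ (1 - β)` once `u` is large (`exists_forall_exponent_lt`).

*Degenerate samples.* To find such a facet the hull should be a neighborhood of the origin. The
vertices `± ε eⱼ` of a small cross-polytope are therefore added to the sample; the facets are then
read off from the vertices of the (bounded) polar polytope, as solutions of linear systems
(`exists_facetNormal_of_notMem_convexHull`). The resulting bound does not depend on `ε`, and the
added points are removed by letting `ε → 0` (`subset_convexHull_of_forall_crossVertex`), which is
possible since `r K` meets every open halfspace with the origin on its boundary.
-/

open scoped ENNReal Topology

/-! ### The Prékopa–Leindler and Brunn–Minkowski inequalities -/

lemma volume_image_mul_add {c : ℝ} (hc : 0 < c) (d : ℝ) (A : Set ℝ) :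
    volume ((fun x => c * x + d) '' A) = ENNReal.ofReal c * volume A := by
  have h1 : (fun x => c * x + d) '' A = (fun x => x + d) '' (c • A) := by
    rw [← Set.image_smul, Set.image_image]; rfl
  have h2 : (fun x : ℝ => x + d) '' (c • A) = (fun x => x + (-d)) ⁻¹' (c • A) :=
    Set.image_add_right
  rw [h1, h2, measure_preimage_add_right, Measure.addHaar_smul]
  simp [abs_of_pos hc]

lemma volume_convex_combination_le_of_isCompact {a b : ℝ} (ha : 0 < a) (hb : 0 < b)
    {A B C : Set ℝ} (hA : IsCompact A) (hB : IsCompact B) (hA0 : A.Nonempty) (hB0 : B.Nonempty)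
    (hC : ∀ x ∈ A, ∀ y ∈ B, a * x + b * y ∈ C) :
    ENNReal.ofReal a * volume A + ENNReal.ofReal b * volume B ≤ volume C := by
  obtain ⟨x₀, hx₀, hx₀'⟩ := hA.exists_isGreatest hA0
  obtain ⟨y₀, hy₀, hy₀'⟩ := hB.exists_isLeast hB0
  -- two translates lying side by side, sharing only the point `a * x₀ + b * y₀`
  have key : volume ((fun x => a * x + b * y₀) '' A ∪ (fun y => b * y + a * x₀) '' B) =
      ENNReal.ofReal a * volume A + ENNReal.ofReal b * volume B := by
    rw [measure_union₀, volume_image_mul_add ha, volume_image_mul_add hb]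
    · exact (hB.image (by fun_prop)).measurableSet.nullMeasurableSet
    · refine measure_mono_null (t := {a * x₀ + b * y₀}) ?_ (by simp)
      rintro z ⟨⟨x, hx, rfl⟩, ⟨y, hy, h⟩⟩
      simp only at h
      have h1 := mul_le_mul_of_nonneg_left (hx₀' hx) ha.le
      have h2 := mul_le_mul_of_nonneg_left (hy₀' hy) hb.le
      simp only [Set.mem_singleton_iff]
      linarith
  rw [← key]
  refine measure_mono ?_
  rintro z (⟨x, hx, rfl⟩ | ⟨y, hy, rfl⟩)
  · exact hC x hx y₀ hy₀
  · simpa [add_comm] using hC x₀ hx₀ y hy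

/-- The Brunn–Minkowski inequality on the line. -/
lemma volume_convex_combination_le {a b : ℝ} (ha : 0 < a) (hb : 0 < b)
    {A B C : Set ℝ} (hA : MeasurableSet A) (hB : MeasurableSet B)
    (hA0 : A.Nonempty) (hB0 : B.Nonempty)
    (hC : ∀ x ∈ A, ∀ y ∈ B, a * x + b * y ∈ C) :
    ENNReal.ofReal a * volume A + ENNReal.ofReal b * volume B ≤ volume C := by
  obtain ⟨x₀, hx₀⟩ := hA0
  obtain ⟨y₀, hy₀⟩ := hB0
  have step : ∀ K ⊆ A, IsCompact K → K.Nonempty →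
      ENNReal.ofReal a * volume K + ENNReal.ofReal b * volume B ≤ volume C := by
    intro K hKA hK hK0
    have hfin : ENNReal.ofReal a * volume K ≠ ∞ :=
      ENNReal.mul_ne_top ENNReal.ofReal_ne_top hK.measure_ne_top
    have hK' : ENNReal.ofReal a * volume K ≤ volume C :=
      le_trans le_self_add (volume_convex_combination_le_of_isCompact ha hb hK
        (isCompact_singleton (x := y₀)) hK0 (Set.singleton_nonempty _)
        (fun x hx y hy => hC x (hKA hx) y (by simp_all)))
    suffices h : ENNReal.ofReal b * volume B ≤ volume C - ENNReal.ofReal a * volume K by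
      calc _ ≤ ENNReal.ofReal a * volume K + (volume C - ENNReal.ofReal a * volume K) := by gcongr
        _ = _ := add_tsub_cancel_of_le hK'
    rw [hB.measure_eq_iSup_isCompact]
    simp only [ENNReal.mul_iSup, iSup_le_iff]
    intro L hLB hL
    refine ENNReal.le_sub_of_add_le_left hfin ?_
    refine le_trans ?_ (volume_convex_combination_le_of_isCompact (C := C) ha hb hK
      (hL.insert y₀) hK0 (Set.insert_nonempty _ _) ?_)
    · gcongr
      exact Set.subset_insert _ _
    · intro x hx y hy
      exact hC x (hKA hx) y (Set.insert_subset hy₀ hLB hy)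
  have hB' : ENNReal.ofReal b * volume B ≤ volume C :=
    le_trans le_add_self (step {x₀} (by simpa using hx₀) isCompact_singleton
      (Set.singleton_nonempty _))
  by_cases htop : ENNReal.ofReal b * volume B = ∞
  · rw [htop] at hB' ⊢
    simpa using hB'
  suffices h : ENNReal.ofReal a * volume A ≤ volume C - ENNReal.ofReal b * volume B by
    calc _ ≤ (volume C - ENNReal.ofReal b * volume B) + ENNReal.ofReal b * volume B := by gcongr
      _ = _ := tsub_add_cancel_of_le hB'
  rw [hA.measure_eq_iSup_isCompact]
  simp only [ENNReal.mul_iSup, iSup_le_iff]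
  intro K hKA hK
  refine ENNReal.le_sub_of_add_le_right htop ?_
  refine le_trans ?_ (step (insert x₀ K) (Set.insert_subset hx₀ hKA) (hK.insert x₀)
    (Set.insert_nonempty _ _))
  gcongr
  exact Set.subset_insert _ _

/-- A layer-cake formula for `ℝ≥0∞`-valued functions, restricted to the levels in `(0, 1)`. -/
lemma lintegral_Ioo_measure_lt {α : Type*} [MeasurableSpace α] (μ : Measure α) [SFinite μ]
    {f : α → ℝ≥0∞} (hf : Measurable f) :
    ∫⁻ t in Set.Ioo (0 : ℝ) 1, μ {x | ENNReal.ofReal t < f x} = ∫⁻ x, min (f x) 1 ∂μ := by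
  have hmeas : MeasurableSet {p : ℝ × α | ENNReal.ofReal p.1 < f p.2} :=
    measurableSet_lt (by fun_prop) (by fun_prop)
  calc ∫⁻ t in Set.Ioo (0 : ℝ) 1, μ {x | ENNReal.ofReal t < f x}
      = ((volume.restrict (Set.Ioo (0 : ℝ) 1)).prod μ)
          {p : ℝ × α | ENNReal.ofReal p.1 < f p.2} := by
        rw [Measure.prod_apply hmeas]; rfl
    _ = ∫⁻ x, (volume.restrict (Set.Ioo (0 : ℝ) 1)) {t | ENNReal.ofReal t < f x} ∂μ := by
        rw [Measure.prod_apply_symm hmeas]; rfl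
    _ = ∫⁻ x, min (f x) 1 ∂μ := by
        refine lintegral_congr fun x => ?_
        have hne : min (f x) 1 ≠ ∞ := ne_top_of_le_ne_top ENNReal.one_ne_top (min_le_right _ _)
        have hset : {t | ENNReal.ofReal t < f x} ∩ Set.Ioo (0 : ℝ) 1 =
            Set.Ioo 0 (min (f x) 1).toReal := by
          ext t
          simp only [Set.mem_inter_iff, Set.mem_ofPred_eq, Set.mem_Ioo]
          constructor
          · rintro ⟨h1, h2, h3⟩
            refine ⟨h2, ?_⟩
            rw [← ENNReal.ofReal_lt_iff_lt_toReal h2.le hne, lt_min_iff]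
            exact ⟨h1, by simpa using h3⟩
          · rintro ⟨h2, h3⟩
            rw [← ENNReal.ofReal_lt_iff_lt_toReal h2.le hne, lt_min_iff] at h3
            exact ⟨h3.1, h2, by simpa using h3.2⟩
        rw [Measure.restrict_apply' measurableSet_Ioo, hset, Real.volume_Ioo, sub_zero,
          ENNReal.ofReal_toReal hne]

lemma ENNReal.geom_mean_le_arith_mean_two_weighted {a b : ℝ} (ha : 0 < a) (hb : 0 < b)
    (hab : a + b = 1) (u v : ℝ≥0∞) :
    u ^ a * v ^ b ≤ ENNReal.ofReal a * u + ENNReal.ofReal b * v := by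
  rcases eq_or_ne u ∞ with rfl | hu
  · rw [ENNReal.mul_top (by simpa using ha)]; simp
  rcases eq_or_ne v ∞ with rfl | hv
  · rw [ENNReal.mul_top (by simpa using hb)]; simp
  lift u to NNReal using hu
  lift v to NNReal using hv
  have h := NNReal.geom_mean_le_arith_mean2_weighted a.toNNReal b.toNNReal u v
    (by rw [← Real.toNNReal_add ha.le hb.le, hab, Real.toNNReal_one])
  rw [Real.coe_toNNReal _ ha.le, Real.coe_toNNReal _ hb.le] at h
  rw [← ENNReal.coe_rpow_of_nonneg _ ha.le, ← ENNReal.coe_rpow_of_nonneg _ hb.le]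
  rw [ENNReal.ofReal, ENNReal.ofReal]
  exact_mod_cast h

/-- One-dimensional Prékopa–Leindler for functions with supremum `1`, in its stronger
arithmetic-mean form: apply the one-dimensional Brunn–Minkowski inequality to the level sets. -/
lemma arith_mean_lintegral_le_of_iSup_eq_one {a b : ℝ} (ha : 0 < a) (hb : 0 < b)
    {f g h : ℝ → ℝ≥0∞} (hf : Measurable f) (hg : Measurable g) (hh : Measurable h)
    (hab : a + b = 1)
    (hf1 : ⨆ x, f x = 1) (hg1 : ⨆ x, g x = 1)
    (hfgh : ∀ x y, f x ^ a * g y ^ b ≤ h (a * x + b * y)) :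
    ENNReal.ofReal a * (∫⁻ x, f x) + ENNReal.ofReal b * ∫⁻ x, g x ≤ ∫⁻ x, h x := by
  have hlevel : ∀ {k : ℝ → ℝ≥0∞}, Measurable k → ⨆ x, k x = 1 →
      ∫⁻ t in Set.Ioo (0 : ℝ) 1, volume {x | ENNReal.ofReal t < k x} = ∫⁻ x, k x := by
    intro k hk hk1
    rw [lintegral_Ioo_measure_lt _ hk]
    exact lintegral_congr fun x => min_eq_left (hk1 ▸ le_iSup k x)
  have hmeas : ∀ {k : ℝ → ℝ≥0∞}, Measurable k →
      Measurable fun t : ℝ => volume {x | ENNReal.ofReal t < k x} := by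
    intro k hk
    exact measurable_measure_prodMk_left (ν := (volume : Measure ℝ))
      (s := {p : ℝ × ℝ | ENNReal.ofReal p.1 < k p.2})
      (measurableSet_lt (by fun_prop) (by fun_prop))
  calc ENNReal.ofReal a * (∫⁻ x, f x) + ENNReal.ofReal b * ∫⁻ x, g x
      = ∫⁻ t in Set.Ioo (0 : ℝ) 1, (ENNReal.ofReal a * volume {x | ENNReal.ofReal t < f x} +
          ENNReal.ofReal b * volume {x | ENNReal.ofReal t < g x}) := by
        rw [lintegral_add_left ((hmeas hf).const_mul _), lintegral_const_mul _ (hmeas hf),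
          lintegral_const_mul _ (hmeas hg), hlevel hf hf1, hlevel hg hg1]
    _ ≤ ∫⁻ t in Set.Ioo (0 : ℝ) 1, volume {x | ENNReal.ofReal t < h x} := by
        refine setLIntegral_mono (hmeas hh) fun t ht => ?_
        have ht1 : ENNReal.ofReal t < 1 := by simpa using ht.2
        refine volume_convex_combination_le ha hb (measurableSet_lt measurable_const hf)
          (measurableSet_lt measurable_const hg) (let ⟨x, hx⟩ := lt_iSup_iff.1 (hf1 ▸ ht1); ⟨x, hx⟩)
          (let ⟨x, hx⟩ := lt_iSup_iff.1 (hg1 ▸ ht1); ⟨x, hx⟩) fun x hx y hy => ?_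
        refine lt_of_lt_of_le ?_ (hfgh x y)
        have h1 : ENNReal.ofReal t = ENNReal.ofReal t ^ a * ENNReal.ofReal t ^ b := by
          rw [← ENNReal.rpow_add_of_nonneg _ _ ha.le hb.le, hab, ENNReal.rpow_one]
        rw [h1]
        exact ENNReal.mul_lt_mul (ENNReal.rpow_lt_rpow hx ha) (ENNReal.rpow_lt_rpow hy hb)
    _ = ∫⁻ x, min (h x) 1 := lintegral_Ioo_measure_lt _ hh
    _ ≤ ∫⁻ x, h x := lintegral_mono fun x => min_le_left _ _

/-- The bounded case: divide `f` and `g` by their suprema `F` and `G`, and `h` by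
`F ^ a * G ^ b`. -/
lemma prekopa_leindler_real_of_iSup_ne_top {a b : ℝ} (ha : 0 < a) (hb : 0 < b) (hab : a + b = 1)
    {f g h : ℝ → ℝ≥0∞} (hf : Measurable f) (hg : Measurable g) (hh : Measurable h)
    (hf1 : ⨆ x, f x ≠ ∞) (hg1 : ⨆ x, g x ≠ ∞)
    (hfgh : ∀ x y, f x ^ a * g y ^ b ≤ h (a * x + b * y)) :
    (∫⁻ x, f x) ^ a * (∫⁻ x, g x) ^ b ≤ ∫⁻ x, h x := by
  set F := ⨆ x, f x with hF
  set G := ⨆ x, g x with hG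
  rcases eq_or_ne F 0 with hF0 | hF0
  · have : ∀ x, f x = 0 := by simpa [hF] using hF0
    simp [this, ENNReal.zero_rpow_of_pos ha]
  rcases eq_or_ne G 0 with hG0 | hG0
  · have : ∀ x, g x = 0 := by simpa [hG] using hG0
    simp [this, ENNReal.zero_rpow_of_pos hb]
  have hFa0 : F ^ a ≠ 0 := by simp [ENNReal.rpow_eq_zero_iff, hF0, hf1]
  have hGb0 : G ^ b ≠ 0 := by simp [ENNReal.rpow_eq_zero_iff, hG0, hg1]
  have hFa1 : F ^ a ≠ ∞ := ENNReal.rpow_ne_top_of_nonneg ha.le hf1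
  have hGb1 : G ^ b ≠ ∞ := ENNReal.rpow_ne_top_of_nonneg hb.le hg1
  have key := arith_mean_lintegral_le_of_iSup_eq_one ha hb (hf.const_mul F⁻¹) (hg.const_mul G⁻¹)
    (hh.const_mul (F ^ a * G ^ b)⁻¹) hab
    (by rw [← ENNReal.mul_iSup, ← hF, ENNReal.inv_mul_cancel hF0 hf1])
    (by rw [← ENNReal.mul_iSup, ← hG, ENNReal.inv_mul_cancel hG0 hg1])
    (fun x y => by
      rw [ENNReal.mul_rpow_of_nonneg _ _ ha.le, ENNReal.mul_rpow_of_nonneg _ _ hb.le,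
        ENNReal.inv_rpow, ENNReal.inv_rpow, ENNReal.mul_inv (Or.inl hFa0) (Or.inl hFa1)]
      calc _ = (F ^ a)⁻¹ * (G ^ b)⁻¹ * (f x ^ a * g y ^ b) := by ring
        _ ≤ _ := by gcongr; exact hfgh x y)
  have key2 := (ENNReal.geom_mean_le_arith_mean_two_weighted ha hb hab _ _).trans key
  rw [lintegral_const_mul _ hf, lintegral_const_mul _ hg, lintegral_const_mul _ hh,
    ENNReal.mul_rpow_of_nonneg _ _ ha.le, ENNReal.mul_rpow_of_nonneg _ _ hb.le,
    ENNReal.inv_rpow, ENNReal.inv_rpow] at key2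
  have h1 : (F ^ a * G ^ b) * (F ^ a * G ^ b)⁻¹ = 1 :=
    ENNReal.mul_inv_cancel (mul_ne_zero hFa0 hGb0) (ENNReal.mul_ne_top hFa1 hGb1)
  calc (∫⁻ x, f x) ^ a * (∫⁻ x, g x) ^ b
      = (F ^ a * (F ^ a)⁻¹) * (G ^ b * (G ^ b)⁻¹) * ((∫⁻ x, f x) ^ a * (∫⁻ x, g x) ^ b) := by
        rw [ENNReal.mul_inv_cancel hFa0 hFa1, ENNReal.mul_inv_cancel hGb0 hGb1]; simp
    _ = (F ^ a * G ^ b) *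
        ((F ^ a)⁻¹ * (∫⁻ x, f x) ^ a * ((G ^ b)⁻¹ * (∫⁻ x, g x) ^ b)) := by ring
    _ ≤ (F ^ a * G ^ b) * ((F ^ a * G ^ b)⁻¹ * ∫⁻ x, h x) := by gcongr
    _ = ∫⁻ x, h x := by rw [← mul_assoc, h1, one_mul]

lemma lintegral_eq_iSup_min_natCast {α : Type*} [MeasurableSpace α] (μ : Measure α)
    {f : α → ℝ≥0∞} (hf : Measurable f) :
    ∫⁻ x, f x ∂μ = ⨆ k : ℕ, ∫⁻ x, min (f x) k ∂μ := by
  rw [← lintegral_iSup (fun k => hf.min measurable_const)]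
  · refine lintegral_congr fun x => ?_
    rw [← inf_iSup_eq]
    simp [ENNReal.iSup_natCast]
  · intro i j hij x
    exact min_le_min le_rfl (by exact_mod_cast hij)

/-- The one-dimensional Prékopa–Leindler inequality, by truncating `f` and `g` at height `k`. -/
lemma prekopa_leindler_real {a b : ℝ} (ha : 0 < a) (hb : 0 < b) (hab : a + b = 1)
    {f g h : ℝ → ℝ≥0∞} (hf : Measurable f) (hg : Measurable g) (hh : Measurable h)
    (hfgh : ∀ x y, f x ^ a * g y ^ b ≤ h (a * x + b * y)) :
    (∫⁻ x, f x) ^ a * (∫⁻ x, g x) ^ b ≤ ∫⁻ x, h x := by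
  have hbd : ∀ (k : ℕ) (q : ℝ → ℝ≥0∞), ⨆ x, min (q x) k ≠ ∞ := fun k q =>
    ne_top_of_le_ne_top (ENNReal.natCast_ne_top k) (iSup_le fun x => min_le_right _ _)
  have main : ∀ k : ℕ, (∫⁻ x, min (f x) k) ^ a * (∫⁻ x, min (g x) k) ^ b ≤ ∫⁻ x, h x :=
    fun k => prekopa_leindler_real_of_iSup_ne_top ha hb hab (hf.min measurable_const)
      (hg.min measurable_const) hh (hbd k f) (hbd k g) fun x y =>
        le_trans (mul_le_mul' (ENNReal.rpow_le_rpow (min_le_left _ _) ha.le)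
          (ENNReal.rpow_le_rpow (min_le_left _ _) hb.le)) (hfgh x y)
  have hsup : ∀ {c : ℝ}, 0 < c → ∀ u : ℕ → ℝ≥0∞, (⨆ k, u k) ^ c = ⨆ k, u k ^ c :=
    fun {c} hc u => (ENNReal.orderIsoRpow c hc).map_iSup u
  rw [lintegral_eq_iSup_min_natCast _ hf, lintegral_eq_iSup_min_natCast _ hg, hsup ha, hsup hb]
  simp only [ENNReal.iSup_mul, ENNReal.mul_iSup, iSup_le_iff]
  intro i j
  refine le_trans ?_ (main (max i j))
  gcongr
  · exact le_max_right i j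
  · exact le_max_left i j

/-- The Prékopa–Leindler inequality on `ℝⁿ`, by induction on `n` through Fubini. -/
theorem prekopa_leindler {a b : ℝ} (ha : 0 < a) (hb : 0 < b) (hab : a + b = 1) (n : ℕ)
    {f g h : (Fin n → ℝ) → ℝ≥0∞} (hf : Measurable f) (hg : Measurable g) (hh : Measurable h)
    (hfgh : ∀ x y, f x ^ a * g y ^ b ≤ h (a • x + b • y)) :
    (∫⁻ x, f x) ^ a * (∫⁻ x, g x) ^ b ≤ ∫⁻ x, h x := by
  induction n with
  | zero =>
    have hsub : ∀ q : (Fin 0 → ℝ) → ℝ≥0∞, ∫⁻ x, q x = q 0 := by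
      intro q
      rw [volume_pi, Measure.pi_of_empty _ 0, lintegral_dirac]
    rw [hsub, hsub, hsub]
    simpa using hfgh 0 0
  | succ n ih =>
    have hmp := (volume_preserving_piFinSuccAbove (fun _ : Fin (n + 1) => ℝ) 0).symm
    have hcons : Measurable fun p : ℝ × (Fin n → ℝ) => (Fin.cons p.1 p.2 : Fin (n + 1) → ℝ) := by
      simpa [MeasurableEquiv.piFinSuccAbove, Fin.insertNthEquiv, Fin.insertNth_zero,
        Function.uncurry_def] using hmp.measurable
    have hsplit : ∀ {q : (Fin (n + 1) → ℝ) → ℝ≥0∞}, Measurable q →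
        ∫⁻ x, q x = ∫⁻ s : ℝ, ∫⁻ x : Fin n → ℝ, q (Fin.cons s x) := by
      intro q hq
      rw [← hmp.lintegral_comp hq, Measure.volume_eq_prod,
        lintegral_prod (fun p => q ((MeasurableEquiv.piFinSuccAbove (fun _ => ℝ) 0).symm p))
          (hq.comp hmp.measurable).aemeasurable]
      simp [MeasurableEquiv.piFinSuccAbove, Fin.insertNthEquiv]
    have hmarg : ∀ {q : (Fin (n + 1) → ℝ) → ℝ≥0∞}, Measurable q →
        Measurable fun s : ℝ => ∫⁻ x : Fin n → ℝ, q (Fin.cons s x) := fun {q} hq =>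
      (hq.comp hcons).lintegral_prod_right'
    rw [hsplit hf, hsplit hg, hsplit hh]
    refine prekopa_leindler_real ha hb hab (hmarg hf) (hmarg hg) (hmarg hh) fun s t => ?_
    have hsec : ∀ {q : (Fin (n + 1) → ℝ) → ℝ≥0∞}, Measurable q → ∀ s : ℝ,
        Measurable fun x : Fin n → ℝ => q (Fin.cons s x) := fun {q} hq s =>
      hq.comp (hcons.comp measurable_prodMk_left)
    refine ih (hsec hf s) (hsec hg t) (hsec hh _) fun x y => ?_
    refine (hfgh _ _).trans_eq ?_
    congr 1
    ext i
    refine Fin.cases ?_ (fun j => ?_) i <;> simp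

/-- The multiplicative Brunn–Minkowski inequality. -/
theorem brunn_minkowski {a b : ℝ} (ha : 0 < a) (hb : 0 < b) (hab : a + b = 1) {n : ℕ}
    {A B C : Set (EuclideanSpace ℝ (Fin n))} (hA : MeasurableSet A) (hB : MeasurableSet B)
    (hC : MeasurableSet C) (hABC : ∀ x ∈ A, ∀ y ∈ B, a • x + b • y ∈ C) :
    volume A ^ a * volume B ^ b ≤ volume C := by
  have hmp := EuclideanSpace.volume_preserving_symm_measurableEquiv_toLp (Fin n)
  have hmp' := hmp.symm
  set e := (MeasurableEquiv.toLp 2 (Fin n → ℝ))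
  have hvol : ∀ {S : Set (EuclideanSpace ℝ (Fin n))}, MeasurableSet S →
      volume S = ∫⁻ x : Fin n → ℝ, (e ⁻¹' S).indicator 1 x := by
    intro S hS
    rw [lintegral_indicator_one (e.measurable hS)]
    exact (hmp'.measure_preimage_equiv S).symm
  rw [hvol hA, hvol hB, hvol hC]
  have hind : ∀ {S : Set (EuclideanSpace ℝ (Fin n))}, MeasurableSet S →
      Measurable ((e ⁻¹' S).indicator (1 : (Fin n → ℝ) → ℝ≥0∞)) :=
    fun hS => measurable_one.indicator (e.measurable hS)
  refine prekopa_leindler ha hb hab n (hind hA) (hind hB) (hind hC) fun x y => ?_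
  by_cases hx : x ∈ e ⁻¹' A
  · by_cases hy : y ∈ e ⁻¹' B
    · have : a • x + b • y ∈ e ⁻¹' C := hABC _ hx _ hy
      simp [Set.indicator_of_mem hx, Set.indicator_of_mem hy, Set.indicator_of_mem this]
    · simp [Set.indicator_of_notMem hy, ENNReal.zero_rpow_of_pos hb]
  · simp [Set.indicator_of_notMem hx, ENNReal.zero_rpow_of_pos ha]

/-! ### Grünbaum's inequality and the mass of caps -/

section TailFunction

variable {ν : Measure ℝ} [IsProbabilityMeasure ν]

lemma antitone_measureReal_Ici (ν : Measure ℝ) [IsProbabilityMeasure ν] :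
    Antitone fun t => ν.real (Set.Ici t) :=
  fun _ _ h => measureReal_mono (Set.Ici_subset_Ici.2 h)

/-- If `X` has law `ν` and `F t = ν [t, ∞)`, then `F X` stochastically dominates the uniform law
on `[0, 1]`. By inner regularity it is enough to look at compact subsets of `{F < s}`, and such a
set lies to the right of its minimum. -/
lemma measure_tail_lt_le (ν : Measure ℝ) [IsProbabilityMeasure ν] (s : ℝ) :
    ν {x | ν.real (Set.Ici x) < s} ≤ ENNReal.ofReal s := by
  have hmeas : MeasurableSet {x | ν.real (Set.Ici x) < s} :=
    measurableSet_lt (antitone_measureReal_Ici ν).measurable measurable_const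
  rw [hmeas.measure_eq_iSup_isCompact]
  simp only [iSup_le_iff]
  intro K hK hKc
  rcases K.eq_empty_or_nonempty with rfl | hne
  · simp
  obtain ⟨x₀, hx₀, hmin⟩ := hKc.exists_isLeast hne
  calc ν K ≤ ν (Set.Ici x₀) := measure_mono fun y hy => hmin hy
    _ = ENNReal.ofReal (ν.real (Set.Ici x₀)) := by simp
    _ ≤ ENNReal.ofReal s := ENNReal.ofReal_le_ofReal (le_of_lt (hK hx₀))

lemma ae_tail_pos (ν : Measure ℝ) [IsProbabilityMeasure ν] :
    ∀ᵐ x ∂ν, 0 < ν.real (Set.Ici x) := by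
  rw [ae_iff]
  refine le_antisymm (ENNReal.le_of_forall_pos_le_add fun ε hε _ => ?_) bot_le
  refine (measure_mono ?_).trans ((measure_tail_lt_le ν ε).trans (by simp))
  intro x hx
  exact lt_of_le_of_lt (not_lt.1 hx) (by exact_mod_cast hε)

lemma lintegral_neg_log_tail_le (ν : Measure ℝ) [IsProbabilityMeasure ν] :
    ∫⁻ x, ENNReal.ofReal (-Real.log (ν.real (Set.Ici x))) ∂ν ≤ 1 := by
  have hnn : ∀ x, 0 ≤ -Real.log (ν.real (Set.Ici x)) := fun x =>
    neg_nonneg.2 (Real.log_nonpos measureReal_nonneg measureReal_le_one)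
  have hmeas : Measurable fun x => -Real.log (ν.real (Set.Ici x)) :=
    (Real.measurable_log.comp (antitone_measureReal_Ici ν).measurable).neg
  rw [lintegral_eq_lintegral_meas_lt ν (Filter.Eventually.of_forall hnn) hmeas.aemeasurable]
  calc ∫⁻ t in Set.Ioi 0, ν {x | t < -Real.log (ν.real (Set.Ici x))}
      ≤ ∫⁻ t in Set.Ioi (0 : ℝ), ENNReal.ofReal (Real.exp (-t)) := by
        refine setLIntegral_mono (by fun_prop) fun t ht => ?_
        refine (measure_mono ?_).trans (measure_tail_lt_le ν _)
        intro x hx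
        have hx' : t < -Real.log (ν.real (Set.Ici x)) := hx
        have ht' : (0 : ℝ) < t := ht
        have hpos : 0 < ν.real (Set.Ici x) := by
          refine lt_of_le_of_ne measureReal_nonneg fun h => ?_
          rw [← h, Real.log_zero] at hx'
          linarith
        show ν.real (Set.Ici x) < Real.exp (-t)
        rw [← Real.log_lt_iff_lt_exp hpos]
        linarith
    _ = 1 := by
        rw [← ofReal_integral_eq_lintegral_ofReal (integrableOn_exp_neg_Ioi 0)
          (Filter.Eventually.of_forall fun t => (Real.exp_pos _).le), integral_exp_neg_Ioi_zero]
        simp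

/-- A log-concave tail function `F` lies below an exponential touching it at `0`. -/
lemma exists_log_tail_le
    (hlc : ∀ s t a b : ℝ, 0 < a → 0 < b → a + b = 1 →
      ν.real (Set.Ici s) ^ a * ν.real (Set.Ici t) ^ b ≤ ν.real (Set.Ici (a * s + b * t)))
    {t₀ : ℝ} (ht₀ : 0 < t₀) (hF₀ : 0 < ν.real (Set.Ici t₀)) :
    ∃ k : ℝ, ∀ t, 0 < ν.real (Set.Ici t) →
      Real.log (ν.real (Set.Ici t)) ≤ Real.log (ν.real (Set.Ici 0)) - k * t := by
  set L : ℝ → ℝ := fun t => Real.log (ν.real (Set.Ici t)) with hL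
  have hpos : ∀ {t : ℝ}, t ≤ t₀ → 0 < ν.real (Set.Ici t) := fun h =>
    hF₀.trans_le (antitone_measureReal_Ici ν h)
  have hslope : ∀ s t : ℝ, s < 0 → 0 < t → 0 < ν.real (Set.Ici t) →
      (L s - L 0) / (-s) ≤ (L 0 - L t) / t := by
    intro s t hs ht hFt
    have hFs : 0 < ν.real (Set.Ici s) := hpos (by linarith)
    have hts : 0 < t - s := by linarith
    have h := hlc s t (t / (t - s)) (-s / (t - s)) (by positivity)
      (div_pos (by linarith) hts) (by field_simp; ring)
    have h0 : t / (t - s) * s + -s / (t - s) * t = 0 := by field_simp; ring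
    rw [h0] at h
    have h1 := Real.log_le_log (by positivity) h
    rw [Real.log_mul (by positivity) (by positivity), Real.log_rpow hFs, Real.log_rpow hFt] at h1
    have h2 : t * L s + -s * L t ≤ (t - s) * L 0 := by
      have := mul_le_mul_of_nonneg_left h1 hts.le
      calc t * L s + -s * L t = (t - s) * (t / (t - s) * L s + -s / (t - s) * L t) := by
            field_simp
        _ ≤ _ := this
    rw [div_le_div_iff₀ (by linarith) ht]
    nlinarith
  have hbdd : BddAbove ((fun s => (L s - L 0) / (-s)) '' Set.Iio 0) := by
    refine ⟨(L 0 - L t₀) / t₀, ?_⟩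
    rintro _ ⟨s, hs, rfl⟩
    exact hslope s t₀ hs ht₀ hF₀
  -- the slope is the left derivative of `-log F` at `0`, as a supremum of difference quotients
  refine ⟨sSup ((fun s => (L s - L 0) / (-s)) '' Set.Iio 0), fun t hFt => ?_⟩
  rcases lt_trichotomy t 0 with ht | rfl | ht
  · have h := le_csSup hbdd ⟨t, ht, rfl⟩
    simp only at h
    rw [div_le_iff₀ (by linarith)] at h
    change L t ≤ L 0 - _
    linarith
  · simp
  · have h : sSup ((fun s => (L s - L 0) / (-s)) '' Set.Iio 0) ≤ (L 0 - L t) / t := by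
      refine csSup_le (Set.Nonempty.image _ ⟨-1, by simp⟩) ?_
      rintro _ ⟨s, hs, rfl⟩
      exact hslope s t hs ht hFt
    rw [le_div_iff₀ ht] at h
    change L t ≤ L 0 - _
    linarith

/-- Grünbaum's inequality for laws on the line with log-concave tails: Jensen's inequality for the
concave function `log F` gives `log F(0) ≥ E log F(X) ≥ -1`. -/
theorem exp_neg_one_le_tail_zero (hint : Integrable (fun x : ℝ => x) ν) (hmean : ∫ x, x ∂ν = 0)
    (hlc : ∀ s t a b : ℝ, 0 < a → 0 < b → a + b = 1 →
      ν.real (Set.Ici s) ^ a * ν.real (Set.Ici t) ^ b ≤ ν.real (Set.Ici (a * s + b * t))) :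
    Real.exp (-1) ≤ ν.real (Set.Ici 0) := by
  by_cases hex : ∃ t₀ : ℝ, 0 < t₀ ∧ 0 < ν.real (Set.Ici t₀)
  · obtain ⟨t₀, ht₀, hF₀⟩ := hex
    obtain ⟨k, hk⟩ := exists_log_tail_le hlc ht₀ hF₀
    have hF : 0 < ν.real (Set.Ici 0) := hF₀.trans_le (antitone_measureReal_Ici ν ht₀.le)
    have hnn : ∀ x, 0 ≤ -Real.log (ν.real (Set.Ici x)) := fun x =>
      neg_nonneg.2 (Real.log_nonpos measureReal_nonneg measureReal_le_one)
    have hmeas : Measurable fun x => -Real.log (ν.real (Set.Ici x)) :=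
      (Real.measurable_log.comp (antitone_measureReal_Ici ν).measurable).neg
    have hlint := lintegral_neg_log_tail_le ν
    have hintL : Integrable (fun x => -Real.log (ν.real (Set.Ici x))) ν := by
      refine ⟨hmeas.aestronglyMeasurable, ?_⟩
      rw [hasFiniteIntegral_iff_ofReal (Filter.Eventually.of_forall hnn)]
      exact hlint.trans_lt ENNReal.one_lt_top
    have hle1 : ∫ x, -Real.log (ν.real (Set.Ici x)) ∂ν ≤ 1 := by
      rw [integral_eq_lintegral_of_nonneg_ae (Filter.Eventually.of_forall hnn)
        hmeas.aestronglyMeasurable]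
      simpa using ENNReal.toReal_mono ENNReal.one_ne_top hlint
    have hge : ∫ x, (k * x - Real.log (ν.real (Set.Ici 0))) ∂ν ≤
        ∫ x, -Real.log (ν.real (Set.Ici x)) ∂ν := by
      refine integral_mono_ae ((hint.const_mul k).sub (integrable_const _)) hintL ?_
      filter_upwards [ae_tail_pos ν] with x hx
      have := hk x hx
      linarith
    rw [integral_sub (hint.const_mul k) (integrable_const _), integral_const_mul, hmean] at hge
    simp only [mul_zero, integral_const, probReal_univ, one_smul, zero_sub] at hge
    rw [← Real.le_log_iff_exp_le hF]
    linarith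
  -- otherwise `X ≤ 0` almost surely, hence `X = 0` almost surely, as its mean is zero
  · push Not at hex
    have hnonpos : ∀ᵐ x ∂ν, x ≤ 0 := by
      filter_upwards [ae_tail_pos ν] with x hx
      by_contra! hx0
      exact absurd hx (not_lt.2 (hex x hx0))
    have h0 : (fun x : ℝ => -x) =ᵐ[ν] 0 := by
      refine (integral_eq_zero_iff_of_nonneg_ae ?_ hint.neg).1 ?_
      · filter_upwards [hnonpos] with x hx
        simpa using hx
      · exact (integral_neg _).trans (by rw [hmean, neg_zero])
    have h1 : ν (Set.Ici 0) = 1 := by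
      refine (mem_ae_iff_prob_eq_one measurableSet_Ici).1 ?_
      filter_upwards [h0] with x hx
      have : -x = 0 := hx
      exact (neg_eq_zero.1 this).ge
    simp [measureReal_def, h1]

end TailFunction

lemma measureReal_cond_eq {Ω : Type*} [MeasurableSpace Ω] {μ : Measure Ω} {s : Set Ω}
    (hs : MeasurableSet s) (t : Set Ω) : μ[|s].real t = (μ.real s)⁻¹ * μ.real (s ∩ t) := by
  rw [measureReal_def, cond_apply hs, ENNReal.toReal_mul, ENNReal.toReal_inv]
  rfl

/-- Grünbaum's inequality, with the constant `1 / e`: a halfspace whose boundary passes through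
the center of mass of a convex body contains at least the fraction `1 / e` of its volume. -/
theorem exp_neg_one_mul_volume_le {n : ℕ} {K : Set (EuclideanSpace ℝ (Fin n))}
    (hK : IsConvexBody K) (hK0 : IsCentered K) (θ : EuclideanSpace ℝ (Fin n)) :
    Real.exp (-1) ≤ (volume[|K]).real {x | 0 ≤ inner ℝ θ x} := by
  have hKm : MeasurableSet K := hK.isCompact.measurableSet
  have hKfin : volume K ≠ ∞ := hK.isCompact.measure_ne_top
  have hKpos : volume K ≠ 0 := (Measure.measure_pos_of_nonempty_interior _ hK.interior_nonempty).ne'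
  have : IsProbabilityMeasure (volume[|K]) := cond_isProbabilityMeasure_of_finite hKpos hKfin
  have hθ : Measurable fun x : EuclideanSpace ℝ (Fin n) => inner ℝ θ x := by fun_prop
  set ν := (volume[|K]).map (fun x => inner ℝ θ x) with hν
  have : IsProbabilityMeasure ν := Measure.isProbabilityMeasure_map hθ.aemeasurable
  have htail : ∀ t, ν.real (Set.Ici t) =
      (volume.real K)⁻¹ * volume.real (K ∩ {x | t ≤ inner ℝ θ x}) := by
    intro t
    rw [hν, map_measureReal_apply hθ measurableSet_Ici, measureReal_cond_eq hKm]
    rfl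
  have hidK : IntegrableOn (fun x : EuclideanSpace ℝ (Fin n) => x) K :=
    continuousOn_id.integrableOn_compact hK.isCompact
  have hid : Integrable (fun x : EuclideanSpace ℝ (Fin n) => x) (volume[|K]) :=
    hidK.smul_measure (ENNReal.inv_ne_top.2 hKpos)
  have hbar : ∫ x, x ∂(volume[|K]) = 0 := by
    rw [ProbabilityTheory.cond, integral_smul_measure, ENNReal.toReal_inv]
    exact hK0
  have key := exp_neg_one_le_tail_zero (ν := ν) ?_ ?_ ?_
  · rw [hν, map_measureReal_apply hθ measurableSet_Ici] at key
    exact key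
  · rw [hν, integrable_map_measure (by fun_prop) hθ.aemeasurable]
    exact hid.const_inner θ
  · rw [hν, integral_map hθ.aemeasurable (by fun_prop), integral_inner hid, hbar, inner_zero_right]
  · intro s t a b ha hb hab
    have hcap : ∀ u, MeasurableSet (K ∩ {x | u ≤ inner ℝ θ x}) := fun u =>
      hKm.inter (measurableSet_le measurable_const hθ)
    have hbm := brunn_minkowski ha hb hab (hcap s) (hcap t) (hcap (a * s + b * t)) ?_
    · have hfin : volume (K ∩ {x | a * s + b * t ≤ inner ℝ θ x}) ≠ ∞ :=
        measure_ne_top_of_subset Set.inter_subset_left hKfin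
      have h := ENNReal.toReal_mono hfin hbm
      rw [ENNReal.toReal_mul, ← ENNReal.toReal_rpow, ← ENNReal.toReal_rpow] at h
      rw [htail, htail, htail]
      have hV : 0 ≤ (volume.real K)⁻¹ := by positivity
      rw [Real.mul_rpow hV measureReal_nonneg, Real.mul_rpow hV measureReal_nonneg,
        mul_mul_mul_comm, ← Real.rpow_add_of_nonneg hV ha.le hb.le, hab, Real.rpow_one]
      exact mul_le_mul_of_nonneg_left h hV
    · rintro x ⟨hxK, hx⟩ y ⟨hyK, hy⟩
      refine ⟨hK.convex hxK hyK ha.le hb.le hab, ?_⟩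
      simp only [Set.mem_ofPred_eq, inner_add_right, real_inner_smul_right] at hx hy ⊢
      gcongr

/-- A halfspace meeting `r K` contains a fraction at least `(1 - r) ^ n / e` of a centered convex
body `K`: if `r y` is in the halfspace with `y ∈ K`, the homothety `x ↦ (1 - r) x + r y` maps a
half of `K` into it. -/
theorem one_sub_pow_mul_exp_neg_one_le {n : ℕ} {K : Set (EuclideanSpace ℝ (Fin n))}
    (hK : IsConvexBody K) (hK0 : IsCentered K) {r : ℝ} (hr0 : 0 ≤ r) (hr1 : r < 1)
    {θ y : EuclideanSpace ℝ (Fin n)} (hy : y ∈ r • K) {c : ℝ} (hc : c < inner ℝ θ y) :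
    (1 - r) ^ n * Real.exp (-1) ≤ (volume[|K]).real {x | c < inner ℝ θ x} := by
  have hKm : MeasurableSet K := hK.isCompact.measurableSet
  have hKfin : volume K ≠ ∞ := hK.isCompact.measure_ne_top
  obtain ⟨z, hz, rfl⟩ := hy
  have hgr := exp_neg_one_mul_volume_le hK hK0 θ
  rw [measureReal_cond_eq hKm] at hgr ⊢
  have hfin : volume (K ∩ {x | c < inner ℝ θ x}) ≠ ∞ :=
    measure_ne_top_of_subset Set.inter_subset_left hKfin
  have himg : volume.real ((fun x => r • z + (1 - r) • x) '' (K ∩ {x | 0 ≤ inner ℝ θ x})) =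
      (1 - r) ^ n * volume.real (K ∩ {x | 0 ≤ inner ℝ θ x}) := by
    have h1 : (fun x => r • z + (1 - r) • x) '' (K ∩ {x | 0 ≤ inner ℝ θ x}) =
        (fun x => r • z + x) '' ((1 - r) • (K ∩ {x | 0 ≤ inner ℝ θ x})) := by
      rw [← Set.image_smul, Set.image_image]
    rw [h1, measureReal_def, measureReal_def, Set.image_add_left, measure_preimage_add,
      Measure.addHaar_smul]
    rw [ENNReal.toReal_mul, finrank_euclideanSpace_fin, ENNReal.toReal_ofReal (abs_nonneg _),
      abs_of_nonneg (pow_nonneg (by linarith) n)]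
  have hsub : (fun x => r • z + (1 - r) • x) '' (K ∩ {x | 0 ≤ inner ℝ θ x}) ⊆
      K ∩ {x | c < inner ℝ θ x} := by
    rintro _ ⟨x, ⟨hxK, hx⟩, rfl⟩
    refine ⟨hK.convex hz hxK hr0 (by linarith) (by ring), ?_⟩
    simp only [Set.mem_ofPred_eq, inner_add_right, real_inner_smul_right] at hx hc ⊢
    have := mul_nonneg (sub_nonneg.2 hr1.le) hx
    linarith
  have hle := measureReal_mono hsub hfin
  rw [himg] at hle
  calc (1 - r) ^ n * Real.exp (-1)
      ≤ (1 - r) ^ n * ((volume.real K)⁻¹ * volume.real (K ∩ {x | 0 ≤ inner ℝ θ x})) :=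
        mul_le_mul_of_nonneg_left hgr (pow_nonneg (by linarith) n)
    _ = (volume.real K)⁻¹ * ((1 - r) ^ n * volume.real (K ∩ {x | 0 ≤ inner ℝ θ x})) := by ring
    _ ≤ _ := mul_le_mul_of_nonneg_left hle (by positivity)

/-! ### Vertices of the polar and facets of a convex hull -/

/-- The polar of a family of points: the normals `θ` of the halfspaces `{x | ⟪x, θ⟫ ≤ 1}` that
contain every point of the family. -/
def polarSet {ι : Type*} {n : ℕ} (v : ι → EuclideanSpace ℝ (Fin n)) :
    Set (EuclideanSpace ℝ (Fin n)) :=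
  {θ | ∀ i, inner ℝ (v i) θ ≤ 1}

section Polar

variable {ι : Type*} {n : ℕ} {v : ι → EuclideanSpace ℝ (Fin n)}

lemma isClosed_polarSet (v : ι → EuclideanSpace ℝ (Fin n)) : IsClosed (polarSet v) := by
  have : polarSet v = ⋂ i, {θ | inner ℝ (v i) θ ≤ 1} := by
    ext θ; simp [polarSet]
  rw [this]
  exact isClosed_iInter fun i => isClosed_le (by fun_prop) continuous_const

/-- A bounded polar contains no ray. -/
lemma eq_zero_of_isBounded_polarSet (hbd : Bornology.IsBounded (polarSet v))
    {θ : EuclideanSpace ℝ (Fin n)} (hθ : ∀ i, inner ℝ (v i) θ ≤ 0) : θ = 0 := by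
  obtain ⟨R, hR⟩ := hbd.exists_norm_le
  by_contra hne
  have hpos : 0 < ‖θ‖ := norm_pos_iff.2 hne
  have hR0 : 0 ≤ R := (norm_nonneg _).trans (hR 0 fun i => by simp)
  have h := hR (((R + 1) / ‖θ‖) • θ) fun i => by
    rw [real_inner_smul_right]
    exact (mul_nonpos_of_nonneg_of_nonpos (by positivity) (hθ i)).trans zero_le_one
  rw [norm_smul, Real.norm_of_nonneg (by positivity), div_mul_cancel₀ _ hpos.ne'] at h
  linarith

lemma exists_inner_lt_of_notMem_convexHull [Finite ι] {y : EuclideanSpace ℝ (Fin n)}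
    (hy : y ∉ convexHull ℝ (Set.range v)) :
    ∃ (θ : EuclideanSpace ℝ (Fin n)) (u : ℝ), (∀ i, inner ℝ (v i) θ < u) ∧ u < inner ℝ y θ := by
  obtain ⟨f, u, hf, hu⟩ := geometric_hahn_banach_closed_point (convex_convexHull ℝ (Set.range v))
    ((Set.finite_range v).isClosed_convexHull ℝ) hy
  have hinner : ∀ x, inner ℝ x ((InnerProductSpace.toDual ℝ _).symm f) = f x := fun x => by
    rw [real_inner_comm]; exact InnerProductSpace.toDual_symm_apply
  refine ⟨(InnerProductSpace.toDual ℝ _).symm f, u, fun i => ?_, ?_⟩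
  · rw [hinner]; exact hf _ (subset_convexHull ℝ _ ⟨i, rfl⟩)
  · rw [hinner]; exact hu

lemma exists_mem_polarSet_of_notMem_convexHull [Finite ι] [Nonempty ι]
    (hbd : Bornology.IsBounded (polarSet v)) {y : EuclideanSpace ℝ (Fin n)}
    (hy : y ∉ convexHull ℝ (Set.range v)) : ∃ θ ∈ polarSet v, 1 < inner ℝ y θ := by
  obtain ⟨θ, u, hθ, hu⟩ := exists_inner_lt_of_notMem_convexHull hy
  have hupos : 0 < u := by
    by_contra! hu0
    have h0 : θ = 0 := eq_zero_of_isBounded_polarSet hbd fun i => (hθ i).le.trans hu0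
    obtain ⟨i⟩ := ‹Nonempty ι›
    have := hθ i
    simp only [h0, inner_zero_right] at this hu
    linarith
  refine ⟨u⁻¹ • θ, fun i => ?_, ?_⟩
  · rw [real_inner_smul_right, inv_mul_le_one₀ hupos]
    exact (hθ i).le
  · rw [real_inner_smul_right, lt_inv_mul_iff₀ hupos, mul_one]
    exact hu

/-- At a vertex `θ` of the polar, the points whose constraint is tight span the space: otherwise
`θ` could be moved in both directions orthogonally to them. -/
lemma span_tight_eq_top [Finite ι] {θ : EuclideanSpace ℝ (Fin n)}
    (hθ : θ ∈ (polarSet v).extremePoints ℝ) :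
    Submodule.span ℝ (v '' {i | inner ℝ (v i) θ = 1}) = ⊤ := by
  by_contra hne
  obtain ⟨w, hw, hw0⟩ := Submodule.exists_mem_ne_zero_of_ne_bot
    (mt Submodule.orthogonal_eq_bot_iff.1 hne)
  have hmove : ∀ w' : EuclideanSpace ℝ (Fin n),
      (∀ i, inner ℝ (v i) θ = 1 → inner ℝ (v i) w' = 0) →
      ∀ᶠ t : ℝ in 𝓝[>] 0, θ + t • w' ∈ polarSet v := by
    intro w' hw'
    refine Filter.eventually_all.2 fun i => ?_
    by_cases hi : inner ℝ (v i) θ = 1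
    · refine Filter.Eventually.of_forall fun t => ?_
      rw [inner_add_right, real_inner_smul_right, hw' i hi, hi]
      simp
    · have hlt : inner ℝ (v i) θ < 1 := lt_of_le_of_ne (hθ.1 i) hi
      have hcont : Filter.Tendsto (fun t : ℝ => inner ℝ (v i) (θ + t • w')) (𝓝[>] 0)
          (𝓝 (inner ℝ (v i) (θ + (0 : ℝ) • w'))) :=
        (Continuous.tendsto (by fun_prop) 0).mono_left nhdsWithin_le_nhds
      rw [zero_smul, add_zero] at hcont
      exact (hcont.eventually_lt_const hlt).mono fun t ht => ht.le
  have horth : ∀ i, inner ℝ (v i) θ = 1 → inner ℝ (v i) w = 0 := fun i hi =>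
    (Submodule.mem_orthogonal _ _).1 hw _ (Submodule.subset_span ⟨i, hi, rfl⟩)
  obtain ⟨t, ⟨h1, h2⟩, ht⟩ := (((hmove w horth).and (hmove (-w) fun i hi => by
    rw [inner_neg_right, horth i hi, neg_zero])).and self_mem_nhdsWithin).exists
  have hseg : θ ∈ openSegment ℝ (θ + t • w) (θ + t • (-w)) :=
    ⟨1 / 2, 1 / 2, by norm_num, by norm_num, by norm_num, by
      simp only [smul_add, smul_neg]
      rw [add_add_add_comm, ← add_smul]
      norm_num⟩
  have h3 : θ + t • w = θ := hθ.2 h1 h2 hseg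
  have h4 : t • w = 0 := by simpa using h3
  exact hw0 ((smul_eq_zero.1 h4).resolve_left (ne_of_gt ht))

end Polar

/-- The normal `θ` of the hyperplane `{x | ⟪x, θ⟫ = 1}` through `n` linearly independent points,
obtained by solving the linear system; a junk value when the points are dependent. -/
noncomputable def facetNormal {n : ℕ} (w : Fin n → EuclideanSpace ℝ (Fin n)) :
    EuclideanSpace ℝ (Fin n) :=
  WithLp.toLp 2 (Matrix.mulVec (Matrix.of fun i j => w i j)⁻¹ 1)

lemma facetNormal_eq {n : ℕ} {w : Fin n → EuclideanSpace ℝ (Fin n)}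
    (hw : LinearIndependent ℝ w) {θ : EuclideanSpace ℝ (Fin n)}
    (hθ : ∀ i, inner ℝ (w i) θ = 1) : facetNormal w = θ := by
  set A : Matrix (Fin n) (Fin n) ℝ := Matrix.of fun i j => w i j with hA
  have hunit : IsUnit A := by
    rw [← Matrix.linearIndependent_rows_iff_isUnit]
    exact hw.map' (WithLp.linearEquiv 2 ℝ (Fin n → ℝ)).toLinearMap (LinearEquiv.ker _)
  have hmul : A.mulVec θ.ofLp = 1 := by
    ext i
    rw [Pi.one_apply, ← hθ i, PiLp.inner_apply]
    simp [A, Matrix.mulVec, dotProduct, mul_comm]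
  have hdet : IsUnit A.det := (Matrix.isUnit_iff_isUnit_det A).1 hunit
  rw [facetNormal, ← hA, ← hmul, Matrix.mulVec_mulVec, Matrix.nonsing_inv_mul _ hdet,
    Matrix.one_mulVec]

lemma measurable_facetNormal {n : ℕ} :
    Measurable (facetNormal : (Fin n → EuclideanSpace ℝ (Fin n)) → _) := by
  have hA : Continuous fun w : Fin n → EuclideanSpace ℝ (Fin n) =>
      (Matrix.of fun i j => w i j : Matrix (Fin n) (Fin n) ℝ) :=
    continuous_matrix fun i j => by simp only [Matrix.of_apply]; fun_prop
  have hentry : ∀ i j, Measurable fun w : Fin n → EuclideanSpace ℝ (Fin n) =>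
      (Matrix.of fun i j => w i j : Matrix (Fin n) (Fin n) ℝ)⁻¹ i j := by
    intro i j
    simp only [Matrix.inv_def, Matrix.smul_apply, smul_eq_mul, Ring.inverse_eq_inv']
    exact (hA.matrix_det.measurable.inv).mul
      ((continuous_apply_apply i j).comp hA.matrix_adjugate).measurable
  refine (MeasurableEquiv.toLp 2 (Fin n → ℝ)).measurable.comp (measurable_pi_lambda _ fun i => ?_)
  simp only [Matrix.mulVec, dotProduct, Pi.one_apply, mul_one]
  exact Finset.measurable_sum _ fun j _ => hentry i j

/-- If `y` is outside the convex hull of finitely many points with bounded polar, then `y` is cut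
off by a hyperplane through `n` of these points that has all the points on one side. -/
lemma exists_facetNormal_of_notMem_convexHull {ι : Type*} [Finite ι] [Nonempty ι] {n : ℕ}
    {v : ι → EuclideanSpace ℝ (Fin n)}
    (hbd : Bornology.IsBounded (polarSet v)) {y : EuclideanSpace ℝ (Fin n)}
    (hy : y ∉ convexHull ℝ (Set.range v)) :
    ∃ (S : Finset ι) (hS : S.card = n),
      facetNormal (fun k => v ((S.equivFinOfCardEq hS).symm k)) ∈ polarSet v ∧
      1 < inner ℝ y (facetNormal (fun k => v ((S.equivFinOfCardEq hS).symm k))) := by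
  classical
  obtain ⟨θ₁, hθ₁, hyθ₁⟩ := exists_mem_polarSet_of_notMem_convexHull hbd hy
  have hcomp : IsCompact (polarSet v) :=
    Metric.isCompact_of_isClosed_isBounded (isClosed_polarSet v) hbd
  -- maximize `⟪y, ·⟫` over the polar, at a vertex
  set l : StrongDual ℝ (EuclideanSpace ℝ (Fin n)) := innerSL ℝ y with hl
  have hexp : IsExposed ℝ (polarSet v) (l.toExposed (polarSet v)) :=
    ContinuousLinearMap.toExposed.isExposed
  obtain ⟨θ₂, hθ₂, hmax⟩ := hcomp.exists_isMaxOn ⟨θ₁, hθ₁⟩ l.continuous.continuousOn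
  obtain ⟨θ, hθ⟩ := (hexp.isCompact hcomp).extremePoints_nonempty ⟨θ₂, hθ₂, fun z hz => hmax hz⟩
  have hext : θ ∈ (polarSet v).extremePoints ℝ :=
    hexp.isExtreme.extremePoints_subset_extremePoints hθ
  have hyθ : 1 < inner ℝ y θ := hyθ₁.trans_le (hθ.1.2 θ₁ hθ₁)
  have hspan := span_tight_eq_top hext
  -- extract a basis `b` from the tight points, and the indices `g p` of its elements
  obtain ⟨b, hb, hbspan, hbli⟩ := exists_linearIndependent ℝ (v '' {i | inner ℝ (v i) θ = 1})
  rw [hspan] at hbspan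
  have hb' : ∀ p, p ∈ b → ∃ i, inner ℝ (v i) θ = 1 ∧ v i = p := fun p hp => hb hp
  choose! g hg using hb'
  have hbfin : b.Finite := hbli.setFinite
  have := hbfin.fintype
  have hcard : Fintype.card b = n := by
    have h := finrank_span_set_eq_card hbli
    rw [hbspan, finrank_top, finrank_euclideanSpace_fin] at h
    exact (Set.toFinset_card b).symm.trans h.symm
  have hginj : Set.InjOn g b := fun p hp q hq hpq => by
    rw [← (hg _ hp).2, ← (hg _ hq).2, hpq]
  have hS' : (b.toFinset.image g).card = n := by
    rw [Finset.card_image_of_injOn (by simpa using hginj), Set.toFinset_card, hcard]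
  refine ⟨b.toFinset.image g, hS', ?_⟩
  · set S := b.toFinset.image g with hSdef
    have hSmem : ∀ i : S, v i ∈ b ∧ g (v i) = i ∧ inner ℝ (v i) θ = 1 := by
      rintro ⟨i, hi⟩
      obtain ⟨p, hp, rfl⟩ := Finset.mem_image.1 hi
      have hp' : p ∈ b := by simpa using hp
      have h := (hg _ hp').2
      simp only [h]
      refine ⟨hp', trivial, ?_⟩
      have h1 := (hg _ hp').1
      rwa [h] at h1
    have hli : LinearIndependent ℝ fun k => v ((S.equivFinOfCardEq hS').symm k) := by
      refine hbli.comp (fun k => ⟨v ((S.equivFinOfCardEq hS').symm k), (hSmem _).1⟩) ?_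
      intro k k' hkk
      have h1 : v ((S.equivFinOfCardEq hS').symm k) = v ((S.equivFinOfCardEq hS').symm k') :=
        congrArg Subtype.val hkk
      have h2 := (hSmem ((S.equivFinOfCardEq hS').symm k)).2.1
      rw [h1, (hSmem _).2.1] at h2
      exact (S.equivFinOfCardEq hS').symm.injective (Subtype.ext h2.symm)
    rw [facetNormal_eq hli fun k => (hSmem _).2.2]
    exact ⟨hext.1, hyθ⟩

/-! ### The union bound over facets -/

/-- Let `θ` be a measurable function of the sample that depends only on the points with index in
`T`. By independence, the remaining points all fall into the random set
`{z | (θ, z) ∈ G}` with probability at most `q ^ (N - #T)`, as long as this set has mass at most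
`q`. -/
lemma measure_forall_notMem_le {ι Ω E F : Type*} [Fintype ι] [DecidableEq ι] [MeasurableSpace Ω]
    [MeasurableSpace E] [Nonempty E] [MeasurableSpace F] {P : Measure Ω} [IsProbabilityMeasure P]
    {μ : Measure E} [IsProbabilityMeasure μ] {x : ι → Ω → E} (hx : ∀ i, Measurable (x i))
    (hlaw : ∀ i, P.map (x i) = μ) (hind : iIndepFun x P) (T : Finset ι)
    {θ : (ι → E) → F} (hθ : Measurable θ) (hdep : ∀ z z', (∀ i ∈ T, z i = z' i) → θ z = θ z')
    {G : Set (F × E)} (hG : MeasurableSet G) (q : ℝ≥0∞) :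
    P {ω | μ {z | (θ (fun i => x i ω), z) ∈ G} ≤ q ∧ ∀ i ∉ T, (θ (fun i => x i ω), x i ω) ∈ G} ≤
      q ^ (Fintype.card ι - T.card) := by
  obtain ⟨e⟩ := ‹Nonempty E›
  set U : Ω → (T → E) := fun ω i => x i ω with hU
  set V : Ω → ((Tᶜ : Finset ι) → E) := fun ω i => x i ω with hV
  have hUm : Measurable U := measurable_pi_lambda _ fun i => hx i
  have hVm : Measurable V := measurable_pi_lambda _ fun i => hx i
  have hUV : IndepFun U V P := hind.indepFun_finset T Tᶜ disjoint_compl_right hx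
  have : IsProbabilityMeasure (P.map U) := Measure.isProbabilityMeasure_map hUm.aemeasurable
  have hVlaw : P.map V = Measure.pi fun _ => μ := by
    have h := hind.precomp (g := fun i : (Tᶜ : Finset ι) => (i : ι)) Subtype.val_injective
    have h' := (iIndepFun_iff_map_fun_eq_pi_map fun i => (hx _).aemeasurable).1 h
    simp only [hlaw] at h'
    exact h'
  set ψ : (T → E) → F := fun u => θ fun i => if h : i ∈ T then u ⟨i, h⟩ else e with hψ
  have hψm : Measurable ψ := by
    refine hθ.comp (measurable_pi_lambda _ fun i => ?_)
    by_cases h : i ∈ T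
    · simp only [h, dif_pos]; exact measurable_pi_apply _
    · simp only [h, dif_neg, not_false_eq_true]; exact measurable_const
  have hψU : ∀ ω, θ (fun i => x i ω) = ψ (U ω) := fun ω =>
    hdep _ _ fun i hi => by simp [hU, hi]
  set B : Set ((T → E) × ((Tᶜ : Finset ι) → E)) :=
    {p | μ {z | (ψ p.1, z) ∈ G} ≤ q ∧ ∀ i, (ψ p.1, p.2 i) ∈ G} with hB
  have hBm : MeasurableSet B := by
    refine MeasurableSet.inter ?_ ?_
    · exact measurableSet_le (((measurable_measure_prodMk_left hG).comp hψm).comp measurable_fst)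
        measurable_const
    · have : {p : (T → E) × ((Tᶜ : Finset ι) → E) | ∀ i, (ψ p.1, p.2 i) ∈ G} =
          ⋂ i, (fun p : (T → E) × ((Tᶜ : Finset ι) → E) => (ψ p.1, p.2 i)) ⁻¹' G := by
        ext p; simp
      change MeasurableSet {p : (T → E) × ((Tᶜ : Finset ι) → E) | ∀ i, (ψ p.1, p.2 i) ∈ G}
      rw [this]
      exact MeasurableSet.iInter fun i => hG.preimage <|
        (hψm.comp measurable_fst).prodMk ((measurable_pi_apply i).comp measurable_snd)
  have hfib : ∀ u, (P.map V) (Prod.mk u ⁻¹' B) ≤ q ^ (Fintype.card ι - T.card) := by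
    intro u
    by_cases hu : μ {z | (ψ u, z) ∈ G} ≤ q
    · have hsub : Prod.mk u ⁻¹' B ⊆ Set.univ.pi fun _ => {z | (ψ u, z) ∈ G} :=
        fun w hw i _ => hw.2 i
      refine (measure_mono hsub).trans ?_
      rw [hVlaw, Measure.pi_pi, Finset.prod_const, Finset.card_univ, Fintype.card_coe,
        Finset.card_compl]
      gcongr
    · have : Prod.mk u ⁻¹' B = ∅ := Set.eq_empty_of_forall_notMem fun w hw => hu hw.1
      simp [this]
  calc _ ≤ P ((fun ω => (U ω, V ω)) ⁻¹' B) := by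
        refine measure_mono fun ω hω => ?_
        have hω' := hω
        simp only [Set.mem_ofPred_eq, hψU] at hω'
        exact ⟨hω'.1, fun i => hω'.2 i (Finset.mem_compl.1 i.2)⟩
    _ = ((P.map U).prod (P.map V)) B := by
        rw [← (indepFun_iff_map_prod_eq_prod_map_map hUm.aemeasurable hVm.aemeasurable).1 hUV,
          Measure.map_apply (hUm.prodMk hVm) hBm]
    _ ≤ ∫⁻ _, q ^ (Fintype.card ι - T.card) ∂(P.map U) := by
        have : SFinite (P.map V) := by rw [hVlaw]; infer_instance
        rw [Measure.prod_apply hBm]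
        exact lintegral_mono hfib
    _ = q ^ (Fintype.card ι - T.card) := by simp

/-- The vertices `± ε eⱼ` of a cross-polytope. -/
noncomputable def crossVertex {n : ℕ} (ε : ℝ) (j : Fin n × Bool) : EuclideanSpace ℝ (Fin n) :=
  (if j.2 then ε else -ε) • EuclideanSpace.single j.1 1

lemma inner_crossVertex {n : ℕ} (ε : ℝ) (j : Fin n × Bool) (θ : EuclideanSpace ℝ (Fin n)) :
    inner ℝ (crossVertex ε j) θ = (if j.2 then ε else -ε) * θ j.1 := by
  rw [crossVertex, real_inner_smul_left, EuclideanSpace.inner_single_left]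
  simp

lemma isBounded_polarSet_elim_crossVertex {ι : Type*} {n : ℕ} {ε : ℝ} (hε : 0 < ε)
    (x : ι → EuclideanSpace ℝ (Fin n)) :
    Bornology.IsBounded (polarSet (Sum.elim x (crossVertex ε))) := by
  refine isBounded_iff_forall_norm_le.2 ⟨∑ _ : Fin n, ε⁻¹, fun θ hθ => ?_⟩
  have hcoord : ∀ j, |θ j| ≤ ε⁻¹ := by
    intro j
    have h1 := hθ (Sum.inr (j, true))
    have h2 := hθ (Sum.inr (j, false))
    rw [Sum.elim_inr, inner_crossVertex] at h1 h2
    simp only [if_true, Bool.false_eq_true, if_false] at h1 h2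
    have habs : |θ j| * ε = |θ j * ε| := by rw [abs_mul, abs_of_pos hε]
    rw [← one_div, le_div_iff₀ hε, habs, abs_le]
    constructor <;> linarith
  calc ‖θ‖ ≤ ∑ j, ‖θ j‖ := by
        rw [EuclideanSpace.norm_eq]
        refine Real.sqrt_le_iff.2 ⟨by positivity, ?_⟩
        exact Finset.sum_sq_le_sq_sum_of_nonneg fun i _ => norm_nonneg _
    _ ≤ ∑ _ : Fin n, ε⁻¹ := Finset.sum_le_sum fun j _ => hcoord j

/-- Union bound over the hyperplanes through `n` of the random points and the vertices of a
cross-polytope: each such hyperplane that cuts off a point of `Z` leaves a mass at least `p`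
beyond it, which all the random points not on it have to avoid. -/
lemma measure_not_subset_convexHull_elim_le {n N : ℕ} {Ω : Type*} [MeasurableSpace Ω]
    {P : Measure Ω} [IsProbabilityMeasure P] {μ : Measure (EuclideanSpace ℝ (Fin n))}
    [IsProbabilityMeasure μ] {x : Fin N → Ω → EuclideanSpace ℝ (Fin n)}
    (hx : ∀ i, Measurable (x i)) (hlaw : ∀ i, P.map (x i) = μ) (hind : iIndepFun x P)
    (hN : 0 < N) {Z : Set (EuclideanSpace ℝ (Fin n))} {q : ℝ≥0∞} (hq : q ≤ 1)
    (hZ : ∀ y ∈ Z, ∀ θ, 1 < inner ℝ y θ → μ {z | inner ℝ z θ ≤ 1} ≤ q)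
    {ε : ℝ} (hε : 0 < ε) :
    P {ω | ¬ Z ⊆ convexHull ℝ (Set.range (Sum.elim (fun i => x i ω) (crossVertex ε)))} ≤
      (N + 2 * n).choose n * q ^ (N - n) := by
  classical
  have : Nonempty (Fin N) := ⟨⟨0, hN⟩⟩
  set ι := Fin N ⊕ (Fin n × Bool) with hι
  set θS : {S : Finset ι // S.card = n} → (Fin N → EuclideanSpace ℝ (Fin n)) →
      EuclideanSpace ℝ (Fin n) := fun S z =>
    facetNormal fun k => Sum.elim z (crossVertex ε) ((S.1.equivFinOfCardEq S.2).symm k) with hθS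
  set T : Finset ι → Finset (Fin N) := fun S => Finset.univ.filter fun i => Sum.inl i ∈ S with hT
  have hTcard : ∀ S : Finset ι, (T S).card ≤ S.card := fun S =>
    Finset.card_le_card_of_injOn Sum.inl (fun i hi => by simpa [hT] using hi)
      Sum.inl_injective.injOn
  set G : Set (EuclideanSpace ℝ (Fin n) × EuclideanSpace ℝ (Fin n)) :=
    {p | inner ℝ p.2 p.1 ≤ 1} with hG
  have hGm : MeasurableSet G := measurableSet_le (by fun_prop) measurable_const
  have hbound : ∀ S : {S : Finset ι // S.card = n},
      P {ω | μ {z | (θS S (fun i => x i ω), z) ∈ G} ≤ q ∧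
        ∀ i ∉ T S.1, (θS S (fun i => x i ω), x i ω) ∈ G} ≤ q ^ (N - n) := by
    intro S
    refine (measure_forall_notMem_le hx hlaw hind (T S.1) (θ := θS S) ?_ ?_ hGm q).trans ?_
    · refine measurable_facetNormal.comp (measurable_pi_lambda _ fun k => ?_)
      rcases ((S.1.equivFinOfCardEq S.2).symm k : ι) with i | j
      · exact measurable_pi_apply i
      · exact measurable_const
    · intro z z' hzz'
      simp only [hθS]
      congr 1
      ext1 k
      have hk : ((S.1.equivFinOfCardEq S.2).symm k : ι) ∈ S.1 := Subtype.property _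
      revert hk
      rcases ((S.1.equivFinOfCardEq S.2).symm k : ι) with i | j
      · intro hk
        exact hzz' i (by simpa [hT] using hk)
      · intro _
        rfl
    · rw [Fintype.card_fin]
      exact pow_le_pow_right_of_le_one' hq (by have := hTcard S.1; have := S.2; omega)
  have hcover : {ω | ¬ Z ⊆ convexHull ℝ (Set.range (Sum.elim (fun i => x i ω) (crossVertex ε)))} ⊆
      ⋃ S : {S : Finset ι // S.card = n}, {ω | μ {z | (θS S (fun i => x i ω), z) ∈ G} ≤ q ∧
        ∀ i ∉ T S.1, (θS S (fun i => x i ω), x i ω) ∈ G} := by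
    intro ω hω
    obtain ⟨y, hyZ, hy⟩ := Set.not_subset.1 hω
    obtain ⟨S, hS, h1, h2⟩ := exists_facetNormal_of_notMem_convexHull
      (isBounded_polarSet_elim_crossVertex hε fun i => x i ω) hy
    exact Set.mem_iUnion.2 ⟨⟨S, hS⟩, hZ y hyZ _ h2, fun i _ => h1 (Sum.inl i)⟩
  calc _ ≤ ∑ _S : {S : Finset ι // S.card = n}, q ^ (N - n) :=
        (measure_mono hcover).trans ((measure_iUnion_fintype_le _ _).trans
          (Finset.sum_le_sum fun S _ => hbound S))
    _ = (N + 2 * n).choose n * q ^ (N - n) := by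
        rw [Finset.sum_const, Finset.card_univ, Fintype.card_finset_len, nsmul_eq_mul]
        simp [hι, mul_comm n 2]

lemma crossVertex_mem_convexHull {n : ℕ} {ε δ : ℝ} (hδ : 0 ≤ δ) (h : δ ≤ ε) (j : Fin n × Bool) :
    crossVertex δ j ∈ convexHull ℝ (Set.range (crossVertex (n := n) ε)) := by
  have hmem : ∀ i, crossVertex ε i ∈ convexHull ℝ (Set.range (crossVertex (n := n) ε)) :=
    fun i => subset_convexHull ℝ _ ⟨i, rfl⟩
  rcases hδ.eq_or_lt with rfl | hδ
  · have h0 : crossVertex 0 j = (1 / 2 : ℝ) • crossVertex ε (j.1, true) +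
        (1 / 2 : ℝ) • crossVertex ε (j.1, false) := by
      simp [crossVertex]
    rw [h0]
    exact convex_convexHull ℝ _ (hmem _) (hmem _)
      (by norm_num) (by norm_num) (by norm_num)
  · have hε : 0 < ε := hδ.trans_le h
    have h0 : crossVertex δ j = ((1 + δ / ε) / 2) • crossVertex ε j +
        ((1 - δ / ε) / 2) • crossVertex ε (j.1, !j.2) := by
      rcases j with ⟨j, b⟩
      cases b <;>
      · simp only [crossVertex, smul_smul, ← add_smul, Bool.false_eq_true, if_true, if_false,
          Bool.not_true, Bool.not_false]
        congr 1
        field_simp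
        ring
    have hr : δ / ε ≤ 1 := (div_le_one hε).2 h
    rw [h0]
    exact convex_convexHull ℝ _ (hmem _) (hmem _)
      (by positivity) (by linarith) (by ring)

lemma convexHull_elim_crossVertex_mono {ι : Type*} {n : ℕ} (x : ι → EuclideanSpace ℝ (Fin n))
    {ε δ : ℝ} (hδ : 0 ≤ δ) (h : δ ≤ ε) :
    convexHull ℝ (Set.range (Sum.elim x (crossVertex δ))) ⊆
      convexHull ℝ (Set.range (Sum.elim x (crossVertex ε))) := by
  refine convexHull_min ?_ (convex_convexHull ℝ _)
  rintro _ ⟨i | j, rfl⟩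
  · exact subset_convexHull ℝ _ ⟨Sum.inl i, rfl⟩
  · refine convexHull_mono ?_ (crossVertex_mem_convexHull hδ h j)
    rintro _ ⟨j, rfl⟩
    exact ⟨Sum.inr j, rfl⟩

/-- If `Z` meets every open halfspace bounded by a hyperplane through the origin, and is covered by
the convex hulls of the points `x i` and an arbitrarily small cross-polytope, then it is covered by
the convex hull of the points alone. -/
lemma subset_convexHull_of_forall_crossVertex {ι : Type*} [Finite ι] [Nonempty ι] {n : ℕ}
    {x : ι → EuclideanSpace ℝ (Fin n)} {Z : Set (EuclideanSpace ℝ (Fin n))}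
    (hZ : ∀ θ ≠ 0, ∃ z ∈ Z, 0 < inner ℝ z θ)
    (h : ∀ m : ℕ, Z ⊆ convexHull ℝ (Set.range (Sum.elim x (crossVertex (1 / ((m : ℝ) + 1)))))) :
    Z ⊆ convexHull ℝ (Set.range x) := by
  intro y hy
  by_contra hyx
  obtain ⟨θ, u, hθ, hu⟩ := exists_inner_lt_of_notMem_convexHull hyx
  have hθ0 : θ ≠ 0 := by
    rintro rfl
    obtain ⟨i⟩ := ‹Nonempty ι›
    have := hθ i
    simp only [inner_zero_right] at this hu
    linarith
  obtain ⟨z, hz, hzpos⟩ := hZ θ hθ0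
  have hM : ∀ j, |θ j| ≤ ‖θ‖ := fun j => PiLp.norm_apply_le θ j
  have hbound : ∀ w ∈ Z, inner ℝ w θ ≤ max u 0 := by
    intro w hw
    have hm : ∀ m : ℕ, inner ℝ w θ ≤ max u (1 / ((m : ℝ) + 1) * ‖θ‖) := by
      intro m
      have hconv : Convex ℝ {w | inner ℝ w θ ≤ max u (1 / ((m : ℝ) + 1) * ‖θ‖)} :=
        convex_halfSpace_le (𝕜 := ℝ) (f := fun w => inner ℝ w θ)
          ⟨fun a b => inner_add_left a b θ, fun c a => real_inner_smul_left a θ c⟩ _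
      refine convexHull_min ?_ hconv (h m hw)
      rintro _ ⟨i | j, rfl⟩
      · exact (hθ i).le.trans (le_max_left _ _)
      · refine le_trans ?_ (le_max_right u _)
        rw [Sum.elim_inr, inner_crossVertex]
        have h1 := abs_le.1 (hM j.1)
        have h2 : (0 : ℝ) < 1 / ((m : ℝ) + 1) := by positivity
        split_ifs <;> nlinarith
    have hlim : Filter.Tendsto (fun m : ℕ => max u (1 / ((m : ℝ) + 1) * ‖θ‖)) Filter.atTop
        (𝓝 (max u 0)) := by
      have := tendsto_one_div_add_atTop_nhds_zero_nat (𝕜 := ℝ) |>.mul_const ‖θ‖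
      rw [zero_mul] at this
      exact tendsto_const_nhds.max this
    exact ge_of_tendsto hlim (Filter.Eventually.of_forall hm)
  have hy' := hbound y hy
  have hz' := hbound z hz
  rcases le_total u 0 with hu0 | hu0
  · rw [max_eq_right hu0] at hz'
    linarith
  · rw [max_eq_left hu0] at hy'
    linarith

/-! ### Passage to the limit and the choice of constants -/

/-- The union bound without the auxiliary cross-polytope: the bad events increase to a superset of
the one in question as `ε = 1 / (m + 1)` decreases to `0`. -/
lemma measure_not_subset_convexHull_le {n N : ℕ} {Ω : Type*} [MeasurableSpace Ω]
    {P : Measure Ω} [IsProbabilityMeasure P] {μ : Measure (EuclideanSpace ℝ (Fin n))}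
    [IsProbabilityMeasure μ] {x : Fin N → Ω → EuclideanSpace ℝ (Fin n)}
    (hx : ∀ i, Measurable (x i)) (hlaw : ∀ i, P.map (x i) = μ) (hind : iIndepFun x P)
    (hN : 0 < N) {Z : Set (EuclideanSpace ℝ (Fin n))} {q : ℝ≥0∞} (hq : q ≤ 1)
    (hZ : ∀ y ∈ Z, ∀ θ, 1 < inner ℝ y θ → μ {z | inner ℝ z θ ≤ 1} ≤ q)
    (hZ0 : ∀ θ ≠ 0, ∃ z ∈ Z, 0 < inner ℝ z θ) :
    P {ω | ¬ Z ⊆ convexHull ℝ (Set.range fun i => x i ω)} ≤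
      (N + 2 * n).choose n * q ^ (N - n) := by
  have : Nonempty (Fin N) := ⟨⟨0, hN⟩⟩
  set A : ℕ → Set Ω := fun m => {ω | ¬ Z ⊆ convexHull ℝ
    (Set.range (Sum.elim (fun i => x i ω) (crossVertex (1 / ((m : ℝ) + 1)))))} with hA
  have hmono : Monotone A := by
    intro m k hmk ω hω hsub
    refine hω (hsub.trans (convexHull_elim_crossVertex_mono _ (by positivity) ?_))
    gcongr
  have hcover : {ω | ¬ Z ⊆ convexHull ℝ (Set.range fun i => x i ω)} ⊆ ⋃ m, A m := by
    intro ω hω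
    by_contra hcon
    refine hω (subset_convexHull_of_forall_crossVertex hZ0 fun m => ?_)
    by_contra hm
    exact hcon (Set.mem_iUnion.2 ⟨m, hm⟩)
  refine (measure_mono hcover).trans ?_
  rw [hmono.measure_iUnion]
  exact iSup_le fun m =>
    measure_not_subset_convexHull_elim_le hx hlaw hind hN hq hZ (by positivity)

/-- A centered convex body has points strictly on the positive side of every hyperplane through
the origin. -/
lemma exists_mem_inner_pos {n : ℕ} {K : Set (EuclideanSpace ℝ (Fin n))}
    (hK : IsConvexBody K) (hK0 : IsCentered K) {θ : EuclideanSpace ℝ (Fin n)} (hθ : θ ≠ 0) :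
    ∃ z ∈ K, 0 < inner ℝ z θ := by
  by_contra! hcon
  have hgr := exp_neg_one_mul_volume_le hK hK0 θ
  rw [measureReal_cond_eq hK.isCompact.measurableSet] at hgr
  have hsub : K ∩ {x | 0 ≤ inner ℝ θ x} ⊆ ((ℝ ∙ θ)ᗮ : Submodule ℝ (EuclideanSpace ℝ (Fin n))) := by
    rintro x ⟨hxK, hx⟩
    rw [SetLike.mem_coe, Submodule.mem_orthogonal_singleton_iff_inner_right]
    refine le_antisymm ?_ hx
    rw [real_inner_comm]
    exact hcon x hxK
  have hne : (ℝ ∙ θ)ᗮ ≠ (⊤ : Submodule ℝ (EuclideanSpace ℝ (Fin n))) := by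
    rw [Ne, Submodule.orthogonal_eq_top_iff, Submodule.span_singleton_eq_bot]
    exact hθ
  have hnull : volume.real (K ∩ {x | 0 ≤ inner ℝ θ x}) = 0 := by
    rw [measureReal_def, measure_mono_null hsub (Measure.addHaar_submodule _ _ hne)]
    rfl
  rw [hnull, mul_zero] at hgr
  exact absurd hgr (not_le.2 (Real.exp_pos _))

lemma exp_neg_two_mul_le_one_sub {r : ℝ} (hr0 : 0 ≤ r) (hr : r ≤ 1 / 2) :
    Real.exp (-(2 * r)) ≤ 1 - r := by
  rw [Real.exp_neg, inv_le_comm₀ (Real.exp_pos _) (by linarith)]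
  refine le_trans ?_ (Real.add_one_le_exp (2 * r))
  rw [inv_le_comm₀ (by linarith) (by linarith), inv_le_iff_one_le_mul₀ (by linarith)]
  nlinarith

lemma choose_le_exp {m n : ℕ} (hn : 0 < n) (hm : 0 < m) :
    (m.choose n : ℝ) ≤ Real.exp (n * (1 + Real.log (m / n))) := by
  have hn' : (0 : ℝ) < n := by exact_mod_cast hn
  have hm' : (0 : ℝ) < m := by exact_mod_cast hm
  calc (m.choose n : ℝ) ≤ (m : ℝ) ^ n / n.factorial := Nat.choose_le_pow_div n m
    _ = ((m : ℝ) / n) ^ n * ((n : ℝ) ^ n / n.factorial) := by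
        rw [div_pow]; field_simp
    _ ≤ ((m : ℝ) / n) ^ n * Real.exp n := by
        gcongr
        exact Real.pow_div_factorial_le_exp _ hn'.le n
    _ = Real.exp (n * (1 + Real.log (m / n))) := by
        rw [mul_add, Real.exp_add, mul_one, mul_comm, Real.exp_nat_mul,
          Real.exp_log (by positivity)]

/-- The exponent comparison: the expected number of points in a cap, of order `u ^ (1 - β / 2)`
times `n`, eventually dominates both the entropy of the union bound and `u ^ (1 - β)`. -/
lemma exists_forall_exponent_lt {β : ℝ} (hβ0 : 0 < β) (hβ1 : β < 1) :
    ∃ α : ℝ, 1 < α ∧ ∀ u : ℝ, α ≤ u →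
      1 + Real.log (u + 2) + u ^ (1 - β) < Real.exp (-1) * u ^ (-(β / 2)) * (u - 1) := by
  have hs : 0 < 1 - β / 2 := by linarith
  have hpow : (fun u : ℝ => u ^ (1 - β)) =o[Filter.atTop] fun u : ℝ => u ^ (1 - β / 2) := by
    refine Asymptotics.isLittleO_of_tendsto' ?_
      ((tendsto_rpow_neg_atTop (half_pos hβ0)).congr' ?_)
    · filter_upwards [Filter.eventually_gt_atTop 0] with u hu h
      exact absurd h (Real.rpow_pos_of_pos hu _).ne'
    · filter_upwards [Filter.eventually_gt_atTop 0] with u hu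
      rw [← Real.rpow_sub hu]
      congr 1; ring
  have ho : (fun u : ℝ => (1 + Real.log 2) + Real.log u + u ^ (1 - β)) =o[Filter.atTop]
      fun u : ℝ => u ^ (1 - β / 2) := by
    refine ((Asymptotics.isLittleO_const_left.2 (Or.inr ?_)).add (isLittleO_log_rpow_atTop hs)).add
      hpow
    exact Filter.tendsto_abs_atTop_atTop.comp (tendsto_rpow_atTop hs)
  have hc : 0 < Real.exp (-1) / 4 := by positivity
  obtain ⟨a, ha⟩ := Filter.eventually_atTop.1 (ho.bound hc)
  refine ⟨max a 2, lt_of_lt_of_le one_lt_two (le_max_right _ _), fun u hu => ?_⟩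
  have hu2 : 2 ≤ u := (le_max_right _ _).trans hu
  have hu0 : 0 < u := by linarith
  have h := ha u ((le_max_left _ _).trans hu)
  have hpos : 0 < u ^ (1 - β / 2) := Real.rpow_pos_of_pos hu0 _
  rw [Real.norm_of_nonneg hpos.le] at h
  have h1 := (le_abs_self _).trans h
  have hlog : Real.log (u + 2) ≤ Real.log 2 + Real.log u := by
    rw [← Real.log_mul (by norm_num) hu0.ne']
    exact Real.log_le_log (by linarith) (by linarith)
  have hsplit : u ^ (1 - β / 2) = u ^ (-(β / 2)) * u := by
    rw [sub_eq_neg_add, Real.rpow_add_one hu0.ne']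
  have hpos' : 0 < u ^ (-(β / 2)) := Real.rpow_pos_of_pos hu0 _
  have hlow : Real.exp (-1) / 2 * u ^ (1 - β / 2) ≤ Real.exp (-1) * u ^ (-(β / 2)) * (u - 1) := by
    have h3 : 0 < Real.exp (-1) * u ^ (-(β / 2)) := by positivity
    rw [hsplit]
    nlinarith
  have h4 : 0 < Real.exp (-1) / 4 * u ^ (1 - β / 2) := by positivity
  linarith

theorem theorem1p3 :
    ∃ c₁ : ℝ, 0 < c₁ ∧
      ∀ β : ℝ, 0 < β → β < 1 →
        ∃ α : ℝ, 1 < α ∧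
          ∀ (n : ℕ), 1 ≤ n →
          ∀ (K : Set (EuclideanSpace ℝ (Fin n))), IsConvexBody K → IsCentered K →
          ∀ (N : ℕ), α * (n : ℝ) ≤ (N : ℝ) → (N : ℝ) ≤ Real.exp (n : ℝ) →
          ∀ (Ω : Type*) [MeasurableSpace Ω] (P : Measure Ω) [IsProbabilityMeasure P]
            (x : Fin N → Ω → EuclideanSpace ℝ (Fin n)),
            (∀ i, Measurable (x i)) →
            (∀ i, pdf.IsUniform (x i) K P volume) →
            iIndepFun x P →
            1 - Real.exp (-((N : ℝ) ^ (1 - β) * (n : ℝ) ^ β)) <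
              P.real {ω | (c₁ * β * Real.log ((N : ℝ) / (n : ℝ)) / (n : ℝ)) • K ⊆
                convexHull ℝ (Set.range fun i => x i ω)} := by
  refine ⟨1 / 4, by norm_num, fun β hβ0 hβ1 => ?_⟩
  obtain ⟨α, hα1, hα⟩ := exists_forall_exponent_lt hβ0 hβ1
  refine ⟨α, hα1, fun n hn K hK hK0 N hNα hNexp Ω _ P _ x hx hunif hind => ?_⟩
  have hn0 : (0 : ℝ) < n := by exact_mod_cast hn
  have hn1 : (1 : ℝ) ≤ n := by exact_mod_cast hn
  set u : ℝ := (N : ℝ) / n with hu_def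
  have huα : α ≤ u := (le_div_iff₀ hn0).2 hNα
  have hu1 : 1 < u := hα1.trans_le huα
  have hu0 : 0 < u := by linarith
  have hNu : (N : ℝ) = n * u := by rw [hu_def]; field_simp
  have hnN : n ≤ N := by
    have : (n : ℝ) ≤ N := by nlinarith
    exact_mod_cast this
  have hNpos : 0 < N := by omega
  have hlogpos : 0 < Real.log u := Real.log_pos hu1
  have hlogn : Real.log u ≤ n := by
    rw [Real.log_le_iff_le_exp hu0]
    exact (div_le_self (Nat.cast_nonneg N) hn1).trans hNexp
  set r : ℝ := 1 / 4 * β * Real.log u / n with hr_def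
  have hr0 : 0 < r := by positivity
  have hr1 : r ≤ 1 / 4 := by
    rw [hr_def, div_le_iff₀ hn0]
    nlinarith
  have hrn : n * (2 * r) = β / 2 * Real.log u := by
    rw [hr_def]; field_simp; ring
  -- the mass of the caps cut off `K` by hyperplanes meeting `r K`
  set p : ℝ := Real.exp (-1) * u ^ (-(β / 2)) with hp_def
  have hp0 : 0 < p := by positivity
  have hp1 : p ≤ 1 := mul_le_one₀ (Real.exp_le_one_iff.2 (by norm_num)) (by positivity)
    (Real.rpow_le_one_of_one_le_of_nonpos hu1.le (by linarith))
  have hpr : p ≤ (1 - r) ^ n * Real.exp (-1) := by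
    rw [hp_def, mul_comm]
    gcongr
    calc u ^ (-(β / 2)) = Real.exp (-(2 * r)) ^ n := by
          rw [← Real.exp_nat_mul, mul_neg, hrn, Real.rpow_def_of_pos hu0]
          congr 1; ring
      _ ≤ (1 - r) ^ n := by
          gcongr
          exact exp_neg_two_mul_le_one_sub hr0.le (by linarith)
  have hKpos : volume K ≠ 0 :=
    (Measure.measure_pos_of_nonempty_interior _ hK.interior_nonempty).ne'
  have : IsProbabilityMeasure (volume[|K]) :=
    cond_isProbabilityMeasure_of_finite hKpos hK.isCompact.measure_ne_top
  have hbad := measure_not_subset_convexHull_le (Z := r • K) hx hunif hind hNpos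
    (q := ENNReal.ofReal (1 - p)) (by simpa using hp0.le) ?_ ?_
  · set bad : Set Ω := {ω | ¬ r • K ⊆ convexHull ℝ (Set.range fun i => x i ω)} with hbad_def
    have hbad' : P.real bad ≤ (N + 2 * n).choose n * (1 - p) ^ (N - n) := by
      have h := ENNReal.toReal_mono (ENNReal.mul_ne_top (ENNReal.natCast_ne_top _)
        (ENNReal.pow_ne_top ENNReal.ofReal_ne_top)) hbad
      rwa [ENNReal.toReal_mul, ENNReal.toReal_pow, ENNReal.toReal_natCast,
        ENNReal.toReal_ofReal (by linarith)] at h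
    have hexp : ((N + 2 * n).choose n : ℝ) * (1 - p) ^ (N - n) <
        Real.exp (-((N : ℝ) ^ (1 - β) * (n : ℝ) ^ β)) := by
      have h1 := choose_le_exp (m := N + 2 * n) hn (by omega)
      have hmn : ((N + 2 * n : ℕ) : ℝ) / n = u + 2 := by
        push_cast; rw [hu_def]; field_simp
      rw [hmn] at h1
      have h2 : (1 - p) ^ (N - n) ≤ Real.exp (-(n * (p * (u - 1)))) := by
        calc (1 - p) ^ (N - n) ≤ Real.exp (-p) ^ (N - n) := by
              gcongr
              exact Real.one_sub_le_exp_neg p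
          _ = Real.exp (-(n * (p * (u - 1)))) := by
              rw [← Real.exp_nat_mul, Nat.cast_sub hnN, hNu]
              congr 1; ring
      have h3 : (N : ℝ) ^ (1 - β) * (n : ℝ) ^ β = n * u ^ (1 - β) := by
        rw [hNu, Real.mul_rpow hn0.le hu0.le, mul_right_comm, ← Real.rpow_add hn0]
        simp
      calc _ ≤ Real.exp (n * (1 + Real.log (u + 2))) * Real.exp (-(n * (p * (u - 1)))) := by
            gcongr
        _ = Real.exp (n * (1 + Real.log (u + 2)) + -(n * (p * (u - 1)))) := (Real.exp_add _ _).symm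
        _ < _ := by
            rw [Real.exp_lt_exp, h3]
            have := mul_lt_mul_of_pos_left (hα u huα) hn0
            linarith
    -- subadditivity is used, as the event is not shown to be measurable
    have hunion : 1 ≤ P.real badᶜ + P.real bad := by
      have h := measureReal_union_le (μ := P) badᶜ bad
      rwa [Set.compl_union_self, probReal_univ] at h
    have hgood : badᶜ = {ω | r • K ⊆ convexHull ℝ (Set.range fun i => x i ω)} := by
      ext ω; simp [hbad_def]
    rw [← hgood]
    linarith
  · intro y hy θ hyθ
    have hcap := hpr.trans (one_sub_pow_mul_exp_neg_one_le hK hK0 hr0.le (by linarith) hy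
      (θ := θ) (c := 1) (by rwa [real_inner_comm]))
    have hcompl : {z | inner ℝ z θ ≤ 1} = {z : EuclideanSpace ℝ (Fin n) | 1 < inner ℝ θ z}ᶜ := by
      ext z; simp [real_inner_comm]
    rw [hcompl, ← ofReal_measureReal, probReal_compl_eq_one_sub
      (measurableSet_lt measurable_const (by fun_prop))]
    exact ENNReal.ofReal_le_ofReal (by linarith)
  · intro θ hθ
    obtain ⟨z, hz, hzθ⟩ := exists_mem_inner_pos hK hK0 hθ
    refine ⟨r • z, Set.smul_mem_smul_set hz, ?_⟩
    rw [real_inner_smul_left]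
    positivity
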